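/- Let $(S,\mathfrak m)$ and $(T,\mathfrak n)$ be commutative Noetherian local rings with common residue field $k$, neither of which is a field, and let $\pi_S : S\to k$ and $\pi_T : T\to k$ be the natural surjections. Let $$R = S\times_k T=\{(s,t)\in S\times T : \pi_S(s)=\pi_T(t)\}$$ be their fiber product, a local ring with maximal ideal $\mathfrak m\times\mathfrak n$, and let $\eta_S : R\to S$ and $\eta_T : R\to T$ be the projections, through which $S$-modules and $T$-modules are regarded as $R$-modules. For a finitely generated $R$-module $L$, let $\Omega^2_R L$ denote the second syzygy of $L$ with respect to a minimal free resolution of $L$ over $R$, that is, the image of the differential $F_2\to F_1$ of such a resolution $\cdots\to F_2\to F_1\to F_0\to L\to 0$. Theorem. Let $M$ and $N$ be finitely generated $R$-modules with $\operatorname{Tor}^R_5(M,N)=0$. Then at least one of the following holds: 1. $\operatorname{pd}_R M\le 1$; 2. $\operatorname{pd}_R N\le 1$; 3. $\Omega^2_R M$ is a free $S$-module and $\Omega^2_R N$ is a free $T$-module; 4. $\Omega^2_R M$ is a free $T$-module and $\Omega^2_R N$ is a free $S$-module. Here an $R$-module is called a free $S$-module (respectively, a free $T$-module) if its $R$-module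 structure is induced along $\eta_S$ (respectively, $\eta_T$) from a free module structure over $S$ (respectively, $T$). -/

import Mathlib

open CategoryTheory IsLocalRing

universe u

/-! ### Fiber products of local rings over their common residue field -/

section FiberProduct

variable {S T k : Type*} [CommRing S] [IsLocalRing S] [CommRing T] [IsLocalRing T] [Field k]

/-- The natural surjection `A → k` of a local ring `A` onto its residue field, where the
isomorphism `e` identifies the residue field of `A` with `k`. -/
noncomputable def residueMap {A k : Type*} [CommRing A] [IsLocalRing A] [Field k] (e : ResidueField A ≃+* k) :
    A →+* k :=
  (e : ResidueField A →+* k).comp (residue A)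

theorem residueMap_surjective {A k : Type*} [CommRing A] [IsLocalRing A] [Field k]
    (e : ResidueField A ≃+* k) : Function.Surjective (residueMap e) :=
  e.surjective.comp residue_surjective

instance residueMap_isLocalHom {A k : Type*} [CommRing A] [IsLocalRing A] [Field k]
    (e : ResidueField A ≃+* k) : IsLocalHom (residueMap e) :=
  IsLocalHom.of_surjective _ (residueMap_surjective e)

/-- The fiber product `S ×ₖ T = {(s, t) | π_S s = π_T t} ⊆ S × T` of two local rings over their
common residue field `k`, where `π_S`, `π_T` are the natural surjections onto `k`. -/
noncomputable abbrev fiberProduct (eS : ResidueField S ≃+* k) (eT : ResidueField T ≃+* k) : Subring (S × T) :=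
  RingHom.pullback (residueMap eS) (residueMap eT)

namespace fiberProduct

variable (eS : ResidueField S ≃+* k) (eT : ResidueField T ≃+* k)

/-- The projection `η_S : S ×ₖ T → S`. -/
noncomputable abbrev etaS : fiberProduct eS eT →+* S := RingHom.pullbackFst (residueMap eS) (residueMap eT)

/-- The projection `η_T : S ×ₖ T → T`. -/
noncomputable abbrev etaT : fiberProduct eS eT →+* T := RingHom.pullbackSnd (residueMap eS) (residueMap eT)

instance isLocalRing : IsLocalRing (fiberProduct eS eT) :=
  RingHom.isLocalRing_pullback (residueMap eS) (residueMap eT)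

instance isNoetherianRing [IsNoetherianRing S] [IsNoetherianRing T] :
    IsNoetherianRing (fiberProduct eS eT) := by
  let : Module (fiberProduct eS eT) S := Module.compHom S (etaS eS eT)
  let : Module (fiberProduct eS eT) T := Module.compHom T (etaT eS eT)
  have : RingHomSurjective (etaS eS eT) :=
    ⟨RingHom.surjective_pullbackFst_of_surjective _ _ (residueMap_surjective eT)⟩
  have : RingHomSurjective (etaT eS eT) :=
    ⟨RingHom.surjective_pullbackSnd_of_surjective _ _ (residueMap_surjective eS)⟩
  let lS : S →ₛₗ[etaS eS eT] S :=
    { toFun := id, map_add' := fun _ _ => rfl, map_smul' := fun _ _ => rfl }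
  let lT : T →ₛₗ[etaT eS eT] T :=
    { toFun := id, map_add' := fun _ _ => rfl, map_smul' := fun _ _ => rfl }
  have : IsNoetherian (fiberProduct eS eT) S :=
    (LinearMap.isNoetherian_iff_of_bijective lS Function.bijective_id).2 inferInstance
  have : IsNoetherian (fiberProduct eS eT) T :=
    (LinearMap.isNoetherian_iff_of_bijective lT Function.bijective_id).2 inferInstance
  let j : fiberProduct eS eT →ₗ[fiberProduct eS eT] S × T :=
    { toFun := fun x => (etaS eS eT x, etaT eS eT x)
      map_add' := fun _ _ => rfl
      map_smul' := fun _ _ => rfl }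
  exact isNoetherian_of_injective j fun x y h => Subtype.ext h

end fiberProduct

end FiberProduct

/-! ### Minimal free resolutions and syzygies -/

/-- A minimal free resolution of a finitely generated module `M` over a local ring `A`: an exact
sequence `⋯ → A^{n₂} → A^{n₁} → A^{n₀} → M → 0` in which the image of every differential
`d i : A^{nᵢ₊₁} → A^{nᵢ}` is contained in `𝔪_A · A^{nᵢ}`. -/
structure MinimalFreeResolution (A : Type*) [CommRing A] [IsLocalRing A]
    (M : Type*) [AddCommGroup M] [Module A M] where
  rank : ℕ → ℕ
  d : ∀ i, (Fin (rank (i + 1)) → A) →ₗ[A] (Fin (rank i) → A)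
  ε : (Fin (rank 0) → A) →ₗ[A] M
  ε_surjective : Function.Surjective ε
  exact_zero : Function.Exact (d 0) ε
  exact_succ : ∀ i, Function.Exact (d (i + 1)) (d i)
  minimal : ∀ i, LinearMap.range (d i) ≤ maximalIdeal A • ⊤

namespace MinimalFreeResolution

variable {A : Type*} [CommRing A] [IsLocalRing A] {M : Type*} [AddCommGroup M] [Module A M]

/-- `F.syzygySucc i` is the `(i + 1)`-st syzygy `Ω_A^{i+1} M` computed from the minimal free
resolution `F` of `M`: the image of `d i`, that is, the kernel of the map out of `A^{nᵢ}`. -/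
def syzygySucc (F : MinimalFreeResolution A M) (i : ℕ) : Submodule A (Fin (F.rank i) → A) :=
  LinearMap.range (F.d i)

/-- Every finitely generated module over a local ring has a minimal free cover. -/
theorem exists_cover (A : Type*) [CommRing A] [IsLocalRing A]
    (M : Type*) [AddCommGroup M] [Module A M] [Module.Finite A M] :
    ∃ (n : ℕ) (f : (Fin n → A) →ₗ[A] M), Function.Surjective f ∧
      LinearMap.ker f ≤ maximalIdeal A • ⊤ := by
  let b := Module.finBasis (ResidueField A) (TensorProduct A (ResidueField A) M)
  have hsurj : Function.Surjective (TensorProduct.mk A (ResidueField A) M 1) :=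
    TensorProduct.mk_surjective A M (ResidueField A) residue_surjective
  choose v hv using fun i => hsurj (b i)
  refine ⟨_, Fintype.linearCombination A v, ?_, ?_⟩
  · rw [← LinearMap.range_eq_top, Fintype.range_linearCombination]
    exact IsLocalRing.span_eq_top_of_tmul_eq_basis v b hv
  · intro a ha
    rw [LinearMap.mem_ker, Fintype.linearCombination_apply] at ha
    have h1 : ∑ i, residue A (a i) • b i = 0 := by
      have := congrArg (TensorProduct.mk A (ResidueField A) M 1) ha
      rw [map_sum, map_zero] at this
      rw [← this]
      refine Finset.sum_congr rfl fun i _ => ?_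
      rw [map_smul, hv]
      exact (algebraMap_smul (ResidueField A) (a i) (b i))
    have h2 := Fintype.linearIndependent_iff.1 b.linearIndependent _ h1
    rw [pi_eq_sum_univ' a]
    refine Submodule.sum_mem _ fun i _ => ?_
    exact Submodule.smul_mem_smul ((residue_eq_zero_iff _).1 (h2 i)) trivial

/-- Minimal free resolutions exist, so quantifying over them is never vacuous here. -/
theorem nonempty (A : Type*) [CommRing A] [IsLocalRing A] [IsNoetherianRing A]
    (M : Type*) [AddCommGroup M] [Module A M] [Module.Finite A M] :
    Nonempty (MinimalFreeResolution A M) := by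
  obtain ⟨n₀, ε, hε, hεm⟩ := exists_cover A M
  choose n f hf hfm using
    fun K : (Σ n : ℕ, Submodule A (Fin n → A)) => exists_cover A K.2
  let st : ℕ → Σ n : ℕ, Submodule A (Fin n → A) :=
    fun i => Nat.rec ⟨n₀, LinearMap.ker ε⟩ (fun _ K => ⟨n K, LinearMap.ker (f K)⟩) i
  have hrange : ∀ i, LinearMap.range ((st i).2.subtype ∘ₗ f (st i)) = (st i).2 := fun i => by
    rw [LinearMap.range_comp, LinearMap.range_eq_top.2 (hf _), Submodule.map_top,
      Submodule.range_subtype]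
  refine ⟨{
    rank := fun i => (st i).1
    d := fun i => (st i).2.subtype ∘ₗ f (st i)
    ε := ε
    ε_surjective := hε
    exact_zero := LinearMap.exact_iff.2 (hrange 0).symm
    exact_succ := fun i => LinearMap.exact_iff.2 ?_
    minimal := fun i => ?_ }⟩
  · refine Eq.trans ?_ (hrange (i + 1)).symm
    rw [LinearMap.ker_comp, Submodule.ker_subtype]
    rfl
  · refine (hrange i).le.trans ?_
    cases i with
    | zero => exact hεm
    | succ i => exact hfm (st i)

end MinimalFreeResolution

/-! ### Modules over a quotient ring -/

/-- For a surjective ring homomorphism `f : A → B`, the `A`-module `K` "is a free `B`-module":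
its `A`-action is induced along `f` from a `B`-module structure for which `K` is free. -/
def IsFreeModuleAlong {A B : Type*} [CommRing A] [CommRing B] (f : A →+* B)
    (K : Type*) [AddCommGroup K] [Module A K] : Prop :=
  ∃ _ : Module B K, (∀ (a : A) (x : K), f a • x = a • x) ∧ Module.Free B K

/-! The maximal ideal of `R` is `I ⊕ J` with `I = ker η_T` and `J = ker η_S` both nonzero, `R/J =
S`, `R/I = T`. A second syzygy `K` is the kernel of a map of free modules and lies in `(I ⊕ J)ⁿ`.
For `u + v ∈ K` with `u ∈ Iⁿ`, `v ∈ Jⁿ`, the images of `u` and `v` cancel and lie in `I` and `J`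
coordinatewise, so both vanish: `K` is an `S`-module plus a `T`-module (`isCompl_comap_piFin`).

Since 5 = 1 + 2 + 2, dimension shifting gives `Tor₁(Ω²M, Ω²N) = 0`, hence `Tor₁ = 0` for all pairs
of summands. Let `X` be one of them, an `S`-module, with minimal cover `Rⁿ → X`; its kernel is `U ⊕
Jⁿ` with `U ⊆ Iⁿ`. If `J` kills `Y`, then `Jⁿ ⊗ Y → Rⁿ ⊗ Y` is both zero and injective, so `X = 0`
or `Y = 0`. If `I` kills `Y ≠ 0`, the same argument gives `U = 0`, so `X ≅ Sⁿ`. Hence if both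
syzygies are nonzero, one is free over `S` and the other over `T`; a zero second syzygy means
projective dimension at most one. -/

/-! ### Vanishing of `Tor₁` through presentations -/

section Presentations

variable {R : Type*} [CommRing R]
  {M' F M N' G N E : Type*}
  [AddCommGroup M'] [Module R M'] [AddCommGroup F] [Module R F] [AddCommGroup M] [Module R M]
  [AddCommGroup N'] [Module R N'] [AddCommGroup G] [Module R G] [AddCommGroup N] [Module R N]
  [AddCommGroup E] [Module R E]
  {i : M' →ₗ[R] F} {p : F →ₗ[R] M} {j : N' →ₗ[R] G} {q : G →ₗ[R] N}

/-- `Tor₁(M, N) = 0` can be tested on a flat presentation of `M` if it holds on a flat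
presentation of `N`. -/
theorem rTensor_injective_of_lTensor_injective [Module.Flat R G]
    (hi : Function.Injective i) (hip : Function.Exact i p) (hp : Function.Surjective p)
    (hjq : Function.Exact j q) (hq : Function.Surjective q)
    (h : Function.Injective (j.lTensor M)) : Function.Injective (i.rTensor N) := by
  rw [injective_iff_map_eq_zero]
  intro x hx
  -- Diagram chase: `x` lifts to `y` in `M' ⊗ G`, whose image in `F ⊗ G` comes from `z` in `F ⊗ N'`.
  -- By `h`, `z` dies in `M ⊗ N'`, so it comes from `w` in `M' ⊗ N'`. Flatness of `G` makes `y` the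
  -- image of `w`, whence `x = 0`.
  obtain ⟨y, rfl⟩ := LinearMap.lTensor_surjective M' hq x
  have h1 : (q.lTensor F) (i.rTensor G y) = 0 := by
    rw [← hx, ← LinearMap.comp_apply, ← LinearMap.comp_apply,
      LinearMap.lTensor_comp_rTensor, LinearMap.rTensor_comp_lTensor]
  obtain ⟨z, hz⟩ := (lTensor_exact F hjq hq _).1 h1
  have h2 : (p.rTensor N') z = 0 := by
    apply h
    have : (j.lTensor M) (p.rTensor N' z) = (p.rTensor G) (j.lTensor F z) := by
      rw [← LinearMap.comp_apply, ← LinearMap.comp_apply,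
        LinearMap.lTensor_comp_rTensor, LinearMap.rTensor_comp_lTensor]
    rw [this, hz, map_zero, ← LinearMap.comp_apply, ← LinearMap.rTensor_comp,
      hip.linearMap_comp_eq_zero, LinearMap.rTensor_zero, LinearMap.zero_apply]
  obtain ⟨w, hw⟩ := (rTensor_exact N' hip hp _).1 h2
  have h3 : (j.lTensor M') w = y := by
    apply Module.Flat.rTensor_preserves_injective_linearMap (M := G) i hi
    rw [← hz, ← hw, ← LinearMap.comp_apply, ← LinearMap.comp_apply,
        LinearMap.lTensor_comp_rTensor, LinearMap.rTensor_comp_lTensor]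
  rw [← h3, ← LinearMap.comp_apply, ← LinearMap.lTensor_comp,
      hjq.linearMap_comp_eq_zero, LinearMap.lTensor_zero, LinearMap.zero_apply]

theorem lTensor_injective_of_rTensor_injective [Module.Flat R F]
    (hip : Function.Exact i p) (hp : Function.Surjective p)
    (hj : Function.Injective j) (hjq : Function.Exact j q) (hq : Function.Surjective q)
    (h : Function.Injective (i.rTensor N)) : Function.Injective (j.lTensor M) := by
  rw [LinearMap.lTensor_inj_iff_rTensor_inj]
  refine rTensor_injective_of_lTensor_injective hj hjq hq hip hp ?_
  rwa [LinearMap.lTensor_inj_iff_rTensor_inj]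

/-- Dimension shift: `Tor₁(M, N') = 0` gives `Tor₁(M', N) = 0`. -/
theorem lTensor_injective_shift [Module.Flat R F] [Module.Flat R G]
    (hi : Function.Injective i) (hip : Function.Exact i p) (hp : Function.Surjective p)
    (hjq : Function.Exact j q) (hq : Function.Surjective q)
    {k : N →ₗ[R] E} (hk : Function.Injective k)
    (h : Function.Injective (j.lTensor M)) : Function.Injective (k.lTensor M') := by
  have h1 := rTensor_injective_of_lTensor_injective hi hip hp hjq hq h
  -- The injective composite `M' ⊗ N → F ⊗ N → F ⊗ E` also factors through `M' ⊗ N → M' ⊗ E`.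
  have h2 := (Module.Flat.lTensor_preserves_injective_linearMap (M := F) k hk).comp h1
  rw [← LinearMap.coe_comp, LinearMap.lTensor_comp_rTensor, ← LinearMap.rTensor_comp_lTensor,
    LinearMap.coe_comp] at h2
  exact h2.of_comp

theorem rTensor_injective_shift [Module.Flat R F] [Module.Flat R G]
    (hip : Function.Exact i p) (hp : Function.Surjective p)
    (hj : Function.Injective j) (hjq : Function.Exact j q) (hq : Function.Surjective q)
    {k : M →ₗ[R] E} (hk : Function.Injective k)
    (h : Function.Injective (i.rTensor N)) : Function.Injective (k.rTensor N') := by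
  rw [← LinearMap.lTensor_inj_iff_rTensor_inj]
  refine lTensor_injective_shift hj hjq hq hip hp hk ?_
  rwa [LinearMap.lTensor_inj_iff_rTensor_inj]

/-- If `L ⊗ -` is exact at the middle term of a complex `P₂ → P₁ → P₀`, then it preserves the
injectivity of the inclusion of the image of `P₁ → P₀`. -/
theorem lTensor_range_subtype_injective {P₂ P₁ P₀ : Type*}
    [AddCommGroup P₂] [Module R P₂] [AddCommGroup P₁] [Module R P₁]
    [AddCommGroup P₀] [Module R P₀] (L : Type*) [AddCommGroup L] [Module R L]
    {f : P₂ →ₗ[R] P₁} {g : P₁ →ₗ[R] P₀} (hfg : g ∘ₗ f = 0)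
    (h : Function.Exact (f.lTensor L) (g.lTensor L)) :
    Function.Injective ((LinearMap.range g).subtype.lTensor L) := by
  rw [injective_iff_map_eq_zero]
  intro x hx
  obtain ⟨y, rfl⟩ := LinearMap.lTensor_surjective L g.surjective_rangeRestrict x
  have h1 : (g.lTensor L) y = 0 := by
    rw [← hx, ← LinearMap.comp_apply, ← LinearMap.lTensor_comp]
    rfl
  obtain ⟨z, rfl⟩ := (h _).1 h1
  have h2 : g.rangeRestrict ∘ₗ f = 0 := by
    ext z
    exact DFunLike.congr_fun hfg z
  rw [← LinearMap.comp_apply, ← LinearMap.lTensor_comp, h2, LinearMap.lTensor_zero,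
    LinearMap.zero_apply]

theorem exact_range_subtype_rangeRestrict {P₂ P₁ P₀ : Type*}
    [AddCommGroup P₂] [Module R P₂] [AddCommGroup P₁] [Module R P₁]
    [AddCommGroup P₀] [Module R P₀]
    {f : P₂ →ₗ[R] P₁} {g : P₁ →ₗ[R] P₀} (h : Function.Exact f g) :
    Function.Exact (LinearMap.range f).subtype g.rangeRestrict := by
  intro x
  rw [← Subtype.coe_injective.eq_iff]
  simpa using h x

end Presentations

/-! ### Projective dimension and `Tor` through resolutions -/

/-- A module whose second syzygy vanishes has projective dimension at most one. -/
theorem projectiveDimension_le_one_of_exact {R : Type u} [CommRing R]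
    {M P₀ P₁ : Type u} [AddCommGroup M] [Module R M]
    [AddCommGroup P₀] [Module R P₀] [Module.Projective R P₀]
    [AddCommGroup P₁] [Module R P₁] [Module.Projective R P₁]
    {f : P₁ →ₗ[R] P₀} {g : P₀ →ₗ[R] M} (hf : Function.Injective f)
    (hfg : Function.Exact f g) (hg : Function.Surjective g) :
    projectiveDimension (ModuleCat.of R M) ≤ 1 := by
  have hP₀ := (IsProjective.iff_projective (R := R) P₀).1 inferInstance
  have hP₁ := (IsProjective.iff_projective (R := R) P₁).1 inferInstance
  have hS : (ShortComplex.mk (ModuleCat.ofHom f) (ModuleCat.ofHom g)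
      (by ext x; exact hfg.apply_apply_eq_zero x)).ShortExact :=
    { exact := (ShortComplex.ShortExact.moduleCat_exact_iff_function_exact _).2 hfg
      mono_f := (ModuleCat.mono_iff_injective _).2 hf
      epi_g := (ModuleCat.epi_iff_surjective _).2 hg }
  refine (projectiveDimension_le_iff _ 1).2 ?_
  refine hS.hasProjectiveDimensionLT_X₃ 1 ?_ ?_
  · exact projective_iff_hasProjectiveDimensionLT_one.1 hP₁
  · have := projective_iff_hasProjectiveDimensionLT_one.1 hP₀
    exact hasProjectiveDimensionLT_of_ge _ 1 2 (by norm_num)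

/-- Vanishing of `Tor_{n+1}(M, N)` means exactness of `M ⊗ P` at `n + 1` for a projective
resolution `P` of `N`. -/
theorem exact_lTensor_of_isZero_tor {R : Type u} [CommRing R] {M N : ModuleCat.{u} R} (n : ℕ)
    (h : Limits.IsZero (((Tor (ModuleCat.{u} R) (n + 1)).obj M).obj N))
    (P : ProjectiveResolution N) :
    Function.Exact ((P.complex.d (n + 2) (n + 1)).hom.lTensor M)
      ((P.complex.d (n + 1) n).hom.lTensor M) := by
  have h1 := h.of_iso (P.isoLeftDerivedObj ((MonoidalCategory.tensoringLeft _).obj M) (n + 1)).symm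
  have h2 := (HomologicalComplex.exactAt_iff_isZero_homology _ _).2 h1
  rw [HomologicalComplex.exactAt_iff' _ (n + 2) (n + 1) n (by simp) (by simp)] at h2
  exact (ShortComplex.ShortExact.moduleCat_exact_iff_function_exact _).1 h2

namespace CategoryTheory.ProjectiveResolution

variable {R : Type u} [CommRing R] {N : ModuleCat.{u} R} (P : ProjectiveResolution N)

instance flat_complex_X (n : ℕ) : Module.Flat R (P.complex.X n) :=
  have := (IsProjective.iff_projective (R := R) (P.complex.X n)).2 (P.projective n)
  Module.Flat.of_projective

theorem exact_hom_succ (n : ℕ) :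
    Function.Exact (P.complex.d (n + 2) (n + 1)).hom (P.complex.d (n + 1) n).hom :=
  (ShortComplex.ShortExact.moduleCat_exact_iff_function_exact _).1 (P.exact_succ n)

/-- The augmentation of a projective resolution, as a linear map onto the resolved module. -/
theorem exists_augmentation : ∃ q : P.complex.X 0 →ₗ[R] N,
    Function.Surjective q ∧ Function.Exact (P.complex.d 1 0).hom q := by
  let e : ((ChainComplex.single₀ (ModuleCat.{u} R)).obj N).X 0 ≅ N := Iso.refl _
  refine ⟨(P.π.f 0 ≫ e.hom).hom, ?_, ?_⟩
  · rw [← ModuleCat.epi_iff_surjective]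
    infer_instance
  · have h := (ShortComplex.ShortExact.moduleCat_exact_iff_function_exact _).1 P.exact₀
    intro x
    rw [← h x]
    have he := (ModuleCat.mono_iff_injective e.hom).1 inferInstance
    refine ⟨fun hx => he ?_, fun hx => ?_⟩
    · rw [map_zero]
      exact hx
    · rw [ModuleCat.hom_comp, LinearMap.comp_apply]
      exact (congrArg e.hom.hom hx).trans (map_zero _)

end CategoryTheory.ProjectiveResolution

namespace MinimalFreeResolution

variable {A : Type*} [CommRing A] [IsLocalRing A] {M : Type*} [AddCommGroup M] [Module A M]
  (F : MinimalFreeResolution A M)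

theorem exact_syzygySucc_zero : Function.Exact (F.syzygySucc 0).subtype F.ε := by
  rw [LinearMap.exact_iff, Submodule.range_subtype]
  exact LinearMap.exact_iff.1 F.exact_zero

theorem exact_syzygySucc_succ (i : ℕ) :
    Function.Exact (F.syzygySucc (i + 1)).subtype (F.d i).rangeRestrict :=
  exact_range_subtype_rangeRestrict (F.exact_succ i)

end MinimalFreeResolution

/-- All the shifts are first moved onto `M`, down to `Tor₁(Ω⁴M, N) = 0`, where the auxiliary
resolution `P` of `N` no longer matters. Shifting back along `G` then yields `Tor₁(Ω²M, Ω²N) = 0`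
without comparing `P` with `G`. -/
theorem rTensor_syzygy_injective_of_isZero_tor {R : Type u} [CommRing R] [IsLocalRing R]
    {M N : Type u} [AddCommGroup M] [Module R M] [AddCommGroup N] [Module R N]
    (h : Limits.IsZero
      (((Tor (ModuleCat.{u} R) 5).obj (ModuleCat.of R M)).obj (ModuleCat.of R N)))
    (F : MinimalFreeResolution R M) (G : MinimalFreeResolution R N) :
    Function.Injective ((F.syzygySucc 2).subtype.rTensor (G.syzygySucc 1)) := by
  let P := projectiveResolution (ModuleCat.of R N)
  have h5 : Function.Injective ((LinearMap.range (P.complex.d 5 4).hom).subtype.lTensor M) :=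
    lTensor_range_subtype_injective _ (P.exact_hom_succ 4).linearMap_comp_eq_zero
      (exact_lTensor_of_isZero_tor 4 h P)
  have hP (n : ℕ) := exact_range_subtype_rangeRestrict (P.exact_hom_succ n)
  have hPs (n : ℕ) := (P.complex.d (n + 1) n).hom.surjective_rangeRestrict
  have hF (i : ℕ) := (F.d i).surjective_rangeRestrict
  have hG (i : ℕ) := (G.d i).surjective_rangeRestrict
  have h4 := lTensor_injective_shift (Submodule.subtype_injective _) F.exact_syzygySucc_zero
    F.ε_surjective (hP 3) (hPs 3) (Submodule.subtype_injective _) h5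
  have h3 := lTensor_injective_shift (Submodule.subtype_injective _) (F.exact_syzygySucc_succ 0)
    (hF 0) (hP 2) (hPs 2) (Submodule.subtype_injective _) h4
  have h2 := lTensor_injective_shift (Submodule.subtype_injective _) (F.exact_syzygySucc_succ 1)
    (hF 1) (hP 1) (hPs 1) (Submodule.subtype_injective _) h3
  have h1 := lTensor_injective_shift (Submodule.subtype_injective _) (F.exact_syzygySucc_succ 2)
    (hF 2) (hP 0) (hPs 0) (Submodule.subtype_injective _) h2
  obtain ⟨q, hq, hPq⟩ := P.exists_augmentation
  have hPq' : Function.Exact (LinearMap.range (P.complex.d 1 0).hom).subtype q := by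
    rw [LinearMap.exact_iff, Submodule.range_subtype]
    exact LinearMap.exact_iff.1 hPq
  have h0 : Function.Injective ((F.syzygySucc 4).subtype.rTensor N) :=
    rTensor_injective_of_lTensor_injective (Submodule.subtype_injective _)
      (F.exact_syzygySucc_succ 3) (hF 3) hPq' hq h1
  have g1 := rTensor_injective_shift (F.exact_syzygySucc_succ 3) (hF 3)
    (Submodule.subtype_injective _) G.exact_syzygySucc_zero G.ε_surjective
    (Submodule.subtype_injective _) h0
  exact rTensor_injective_shift (F.exact_syzygySucc_succ 2) (hF 2)
    (Submodule.subtype_injective _) (G.exact_syzygySucc_succ 0) (hG 0)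
    (Submodule.subtype_injective _) g1

/-! ### Vanishing of `Tor₁`: independence of presentation, symmetry, direct summands -/

section TorOne

open TensorProduct

variable (R : Type*) [CommRing R] (M N : Type*) [AddCommGroup M] [Module R M]
  [AddCommGroup N] [Module R N]

/-- `Tor₁(M, N) = 0`, expressed through the presentations of `M` by finite free modules. -/
def TorOneVanishes : Prop :=
  ∀ (n : ℕ) (f : (Fin n → R) →ₗ[R] M), Function.Surjective f →
    Function.Injective ((LinearMap.ker f).subtype.rTensor N)

variable {R M N}

theorem LinearMap.exact_ker_subtype (f : M →ₗ[R] N) :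
    Function.Exact (LinearMap.ker f).subtype f := by
  rw [LinearMap.exact_iff, Submodule.range_subtype]

/-- Symmetry is used twice: the condition passes to a free presentation of `N`, and from there to
any presentation of `M`. -/
theorem TorOneVanishes.of_presentation [Module.Finite R N] {M' F : Type*}
    [AddCommGroup M'] [Module R M'] [AddCommGroup F] [Module R F] [Module.Flat R F]
    {i : M' →ₗ[R] F} {p : F →ₗ[R] M} (hip : Function.Exact i p) (hp : Function.Surjective p)
    (h : Function.Injective (i.rTensor N)) : TorOneVanishes R M N := by
  intro n f hf
  obtain ⟨m, q, hq⟩ := Module.Finite.exists_fin' R N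
  exact rTensor_injective_of_lTensor_injective (Submodule.subtype_injective _)
    f.exact_ker_subtype hf q.exact_ker_subtype hq
    (lTensor_injective_of_rTensor_injective hip hp (Submodule.subtype_injective _)
      q.exact_ker_subtype hq h)

theorem TorOneVanishes.symm [Module.Finite R M] (h : TorOneVanishes R M N) :
    TorOneVanishes R N M := by
  intro n f hf
  obtain ⟨m, q, hq⟩ := Module.Finite.exists_fin' R M
  rw [← LinearMap.lTensor_inj_iff_rTensor_inj]
  exact lTensor_injective_of_rTensor_injective q.exact_ker_subtype hq
    (Submodule.subtype_injective _) f.exact_ker_subtype hf (h m q hq)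

theorem Submodule.rTensor_subtype_injective_of_isCompl {U V : Submodule R M} (h : IsCompl U V)
    (L : Type*) [AddCommGroup L] [Module R L] : Function.Injective (U.subtype.rTensor L) := by
  refine Function.LeftInverse.injective (g := (U.projectionOnto V h).rTensor L) fun x => ?_
  rw [← LinearMap.comp_apply, ← LinearMap.rTensor_comp]
  have : U.projectionOnto V h ∘ₗ U.subtype = LinearMap.id := by
    ext x
    simp
  rw [this, LinearMap.rTensor_id, LinearMap.id_apply]

theorem TorOneVanishes.of_isCompl_right (h : TorOneVanishes R M N) {U V : Submodule R N}
    (hUV : IsCompl U V) : TorOneVanishes R M U := by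
  intro n f hf
  have h1 := (h n f hf).comp
    ((LinearMap.lTensor_inj_iff_rTensor_inj _ _).2
      (Submodule.rTensor_subtype_injective_of_isCompl hUV (LinearMap.ker f)))
  rw [← LinearMap.coe_comp, LinearMap.rTensor_comp_lTensor, ← LinearMap.lTensor_comp_rTensor,
    LinearMap.coe_comp] at h1
  exact h1.of_comp

theorem TorOneVanishes.of_isCompl_left [Module.Finite R M] [Module.Finite R N]
    (h : TorOneVanishes R M N) {U V : Submodule R M}
    (hUV : IsCompl U V) : TorOneVanishes R U N :=
  (h.symm.of_isCompl_right hUV).symm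

theorem IsLocalRing.exists_surjective_residueField [IsLocalRing R] [Module.Finite R M]
    [Nontrivial M] : ∃ f : M →ₗ[R] ResidueField R, Function.Surjective f := by
  obtain ⟨I, ϕ, hI, hϕ⟩ := Module.exists_surjective_quotient_of_finite R M
  exact ⟨Submodule.factor (IsLocalRing.le_maximalIdeal hI) ∘ₗ ϕ,
    (Submodule.factor_surjective (IsLocalRing.le_maximalIdeal hI)).comp hϕ⟩

/-- If both modules are nonzero, each surjects onto the residue field, and multiplication there
makes the tensor product surject onto it too. -/
theorem IsLocalRing.subsingleton_or_subsingleton_of_tensorProduct [IsLocalRing R]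
    [Module.Finite R M] [Module.Finite R N] [h : Subsingleton (M ⊗[R] N)] :
    Subsingleton M ∨ Subsingleton N := by
  by_contra! hc
  obtain ⟨hM, hN⟩ := hc
  obtain ⟨f, hf⟩ := exists_surjective_residueField (R := R) (M := M)
  obtain ⟨g, hg⟩ := exists_surjective_residueField (R := R) (M := N)
  let ψ : M ⊗[R] N →ₗ[R] ResidueField R :=
    (LinearMap.mul' R (ResidueField R)).comp (TensorProduct.map f g)
  have hψ : Function.Surjective ψ := by
    intro x
    obtain ⟨x, rfl⟩ := hf x
    obtain ⟨y, hy⟩ := hg 1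
    exact ⟨x ⊗ₜ y, by simp [ψ, hy]⟩
  exact not_subsingleton _ hψ.subsingleton

end TorOne

/-! ### Local rings whose maximal ideal is a direct sum of two ideals -/

section SplitMaximalIdeal

open TensorProduct

variable {R : Type*} [CommRing R]

/-- The submodule `I ⊕ ⋯ ⊕ I` of `Rⁿ`. -/
abbrev Ideal.piFin (I : Ideal R) (n : ℕ) : Submodule R (Fin n → R) :=
  Submodule.pi Set.univ fun _ => I

theorem Ideal.mem_piFin {I : Ideal R} {n : ℕ} {x : Fin n → R} :
    x ∈ I.piFin n ↔ ∀ i, x i ∈ I := by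
  simp [Ideal.piFin, Submodule.mem_pi]

theorem Ideal.smul_top_le_piFin (I : Ideal R) (n : ℕ) :
    (I • ⊤ : Submodule R (Fin n → R)) ≤ I.piFin n :=
  Submodule.smul_le.2 fun _ hr _ _ => Ideal.mem_piFin.2 fun _ => I.mul_mem_right _ hr

theorem Ideal.disjoint_piFin {I J : Ideal R} (h : Disjoint I J) (n : ℕ) :
    Disjoint (I.piFin n) (J.piFin n) := by
  rw [Submodule.disjoint_def] at h ⊢
  exact fun x hI hJ => funext fun i => h _ (Ideal.mem_piFin.1 hI i) (Ideal.mem_piFin.1 hJ i)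

theorem Ideal.exists_add_of_mem_piFin_sup {I J : Ideal R} {n : ℕ} {x : Fin n → R}
    (hx : x ∈ (I ⊔ J).piFin n) : ∃ u ∈ I.piFin n, ∃ v ∈ J.piFin n, u + v = x := by
  choose u hu v hv huv using fun i => Submodule.mem_sup.1 (Ideal.mem_piFin.1 hx i)
  exact ⟨u, Ideal.mem_piFin.2 hu, v, Ideal.mem_piFin.2 hv, funext huv⟩

theorem LinearMap.map_mem_smul_top_of_mem_piFin {M : Type*} [AddCommGroup M] [Module R M]
    {I : Ideal R} {n : ℕ} (f : (Fin n → R) →ₗ[R] M) {x : Fin n → R} (hx : x ∈ I.piFin n) :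
    f x ∈ (I • ⊤ : Submodule R M) := by
  rw [pi_eq_sum_univ' x, map_sum]
  refine Submodule.sum_mem _ fun i _ => ?_
  rw [map_smul]
  exact Submodule.smul_mem_smul (Ideal.mem_piFin.1 hx i) trivial

/-- The kernel of a map that separates `Iⁿ` from `Jⁿ` splits if it is contained in `(I + J)ⁿ`. -/
theorem isCompl_comap_piFin {M : Type*} [AddCommGroup M] [Module R M] {I J : Ideal R}
    (hIJ : Disjoint I J) {n : ℕ} {f : (Fin n → R) →ₗ[R] M} (hf : LinearMap.ker f ≤ (I ⊔ J).piFin n)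
    (hd : Disjoint (I • ⊤ : Submodule R M) (J • ⊤)) :
    IsCompl ((I.piFin n).comap (LinearMap.ker f).subtype)
      ((J.piFin n).comap (LinearMap.ker f).subtype) := by
  constructor
  · rw [Submodule.disjoint_def]
    exact fun x hI hJ => Subtype.ext
      ((Submodule.disjoint_def.1 (Ideal.disjoint_piFin hIJ n)) x.1 hI hJ)
  · rw [codisjoint_iff, Submodule.eq_top_iff']
    rintro ⟨x, hx⟩
    obtain ⟨u, hu, v, hv, rfl⟩ := Ideal.exists_add_of_mem_piFin_sup (hf hx)
    rw [LinearMap.mem_ker, map_add] at hx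
    have hfu : f u = 0 := by
      refine (Submodule.disjoint_def.1 hd) _ (f.map_mem_smul_top_of_mem_piFin hu) ?_
      rw [eq_neg_of_add_eq_zero_left hx]
      exact neg_mem (f.map_mem_smul_top_of_mem_piFin hv)
    have hfv : f v = 0 := by rwa [hfu, zero_add] at hx
    exact Submodule.mem_sup.2 ⟨⟨u, hfu⟩, hu, ⟨v, hfv⟩, hv, rfl⟩

/-- If `X ≤ Iⁿ` and `I` kills `L`, then `X ⊗ L → Rⁿ ⊗ L` is zero. -/
theorem subsingleton_tensorProduct_of_injective {X L : Type*} [AddCommGroup X] [Module R X]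
    [AddCommGroup L] [Module R L] {I : Ideal R} {n : ℕ} {i : X →ₗ[R] (Fin n → R)}
    (hi : ∀ x, i x ∈ I.piFin n) (hL : (I • ⊤ : Submodule R L) = ⊥)
    (h : Function.Injective (i.rTensor L)) : Subsingleton (X ⊗[R] L) := by
  have h0 : i.rTensor L = 0 := by
    refine TensorProduct.ext' fun x y => ?_
    rw [LinearMap.rTensor_tmul, LinearMap.zero_apply, pi_eq_sum_univ' (i x),
      TensorProduct.sum_tmul]
    refine Finset.sum_eq_zero fun k _ => ?_
    have : i x k • y = 0 := by
      rw [← Submodule.mem_bot R, ← hL]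
      exact Submodule.smul_mem_smul (Ideal.mem_piFin.1 (hi x) k) trivial
    rw [TensorProduct.smul_tmul, this, TensorProduct.tmul_zero]
  exact ⟨fun a b => h (by rw [h0]; rfl)⟩

variable [IsLocalRing R] {I J : Ideal R}
  {M N : Type*} [AddCommGroup M] [Module R M] [Module.Finite R M]
  [AddCommGroup N] [Module R N] [Module.Finite R N]

/-- As `J` kills `M`, the separation condition of `isCompl_comap_piFin` is trivial, and the second
summand is all of `Jⁿ`. -/
theorem exists_cover_isCompl (hIJ : Disjoint I J) (hmax : I ⊔ J = maximalIdeal R)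
    (hM : (J • ⊤ : Submodule R M) = ⊥) :
    ∃ (n : ℕ) (f : (Fin n → R) →ₗ[R] M), Function.Surjective f ∧
      J.piFin n ≤ LinearMap.ker f ∧
      IsCompl ((I.piFin n).comap (LinearMap.ker f).subtype)
        ((J.piFin n).comap (LinearMap.ker f).subtype) := by
  obtain ⟨n, f, hf, hk⟩ := MinimalFreeResolution.exists_cover R M
  refine ⟨n, f, hf, fun x hx => ?_, isCompl_comap_piFin hIJ ?_ ?_⟩
  · rw [LinearMap.mem_ker, ← Submodule.mem_bot R, ← hM]
    exact f.map_mem_smul_top_of_mem_piFin hx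
  · rw [hmax]
    exact hk.trans (Ideal.smul_top_le_piFin _ _)
  · rw [hM]
    exact disjoint_bot_right

variable [IsNoetherianRing R]

/-- `U ⊗ N` is a summand of `K ⊗ N`, so it embeds in `Rⁿ ⊗ N`; that map is also zero, hence `U ⊗ N =
0`. -/
theorem subsingleton_or_subsingleton_of_injective_of_isCompl {n : ℕ}
    {K : Submodule R (Fin n → R)} {U V : Submodule R K}
    (hUV : IsCompl U V) (hU : ∀ x ∈ U, (x : Fin n → R) ∈ I.piFin n)
    (hN : (I • ⊤ : Submodule R N) = ⊥) (h : Function.Injective (K.subtype.rTensor N)) :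
    Subsingleton U ∨ Subsingleton N := by
  have h1 : Function.Injective ((K.subtype ∘ₗ U.subtype).rTensor N) := by
    rw [LinearMap.rTensor_comp]
    exact h.comp (Submodule.rTensor_subtype_injective_of_isCompl hUV N)
  have := subsingleton_tensorProduct_of_injective (fun x : U => hU x.1 x.2) hN h1
  exact IsLocalRing.subsingleton_or_subsingleton_of_tensorProduct (R := R)

/-- Two nonzero modules killed by the same summand of the maximal ideal have nonzero `Tor₁`. -/
theorem TorOneVanishes.subsingleton_or_subsingleton (hIJ : Disjoint I J)
    (hmax : I ⊔ J = maximalIdeal R) (hJ : J ≠ ⊥)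
    (hM : (J • ⊤ : Submodule R M) = ⊥) (hN : (J • ⊤ : Submodule R N) = ⊥)
    (h : TorOneVanishes R M N) : Subsingleton M ∨ Subsingleton N := by
  obtain ⟨n, f, hf, hJf, hc⟩ := exists_cover_isCompl hIJ hmax hM
  refine (subsingleton_or_subsingleton_of_injective_of_isCompl hc.symm (fun _ hx => hx) hN
    (h n f hf)).imp_left fun hV => ?_
  obtain ⟨a, ha, ha0⟩ := Submodule.exists_mem_ne_zero_of_ne_bot hJ
  -- For `n > 0` the constant vector `a` would be a nonzero element of the summand `Jⁿ`.
  obtain rfl : n = 0 := by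
    by_contra hn
    have hx : (fun _ => a : Fin n → R) ∈ J.piFin n := Ideal.mem_piFin.2 fun _ => ha
    have := congrArg (fun y => (y.1.1 : Fin n → R) ⟨0, Nat.pos_of_ne_zero hn⟩)
      (hV.elim ⟨⟨_, hJf hx⟩, hx⟩ 0)
    exact ha0 this
  exact hf.subsingleton

/-- If `Tor₁(M, N) = 0` where `J` kills `M` and `I` kills `N ≠ 0`, then `M` is free over `R ⧸ J`. -/
theorem TorOneVanishes.exists_cover_ker_eq (hIJ : Disjoint I J)
    (hmax : I ⊔ J = maximalIdeal R) [Nontrivial N]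
    (hM : (J • ⊤ : Submodule R M) = ⊥) (hN : (I • ⊤ : Submodule R N) = ⊥)
    (h : TorOneVanishes R M N) :
    ∃ (n : ℕ) (f : (Fin n → R) →ₗ[R] M), Function.Surjective f ∧
      LinearMap.ker f = J.piFin n := by
  obtain ⟨n, f, hf, hJf, hc⟩ := exists_cover_isCompl hIJ hmax hM
  refine ⟨n, f, hf, le_antisymm (fun x hx => ?_) hJf⟩
  have hU := (subsingleton_or_subsingleton_of_injective_of_isCompl hc (fun _ hx => hx) hN
    (h n f hf)).resolve_right (not_subsingleton N)
  rw [Submodule.subsingleton_iff_eq_bot] at hU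
  have hV := eq_top_of_bot_isCompl (hU ▸ hc)
  exact (Submodule.eq_top_iff'.1 hV) ⟨x, hx⟩

end SplitMaximalIdeal

/-! ### Pairs of split modules with vanishing `Tor₁` -/

section SplitSyzygies

variable {R : Type*} [CommRing R] {I J : Ideal R}

theorem Ideal.smul_top_comap_piFin_eq_bot (hIJ : Disjoint I J) {n : ℕ}
    (K : Submodule R (Fin n → R)) :
    (J • ⊤ : Submodule R ((I.piFin n).comap K.subtype)) = ⊥ := by
  refine (Submodule.eq_bot_iff _).2 fun x hx => ?_
  induction hx using Submodule.smul_induction_on' with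
  | smul r hr y _ =>
    refine Subtype.ext (Subtype.ext (funext fun i => ?_))
    exact Submodule.disjoint_def.1 hIJ _ (I.mul_mem_left _ (Ideal.mem_piFin.1 y.2 i))
      (J.mul_mem_right _ hr)
  | add x _ y _ hx hy => rw [hx, hy, add_zero]

variable [IsLocalRing R] [IsNoetherianRing R]
  {K L : Type*} [AddCommGroup K] [Module R K] [Module.Finite R K]
  [AddCommGroup L] [Module R L] [Module.Finite R L]

theorem TorOneVanishes.exists_covers (hIJ : Disjoint I J) (hmax : I ⊔ J = maximalIdeal R)
    [Nontrivial K] [Nontrivial L] {A : Submodule R K} {B : Submodule R L}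
    (hAJ : (J • ⊤ : Submodule R A) = ⊥) (hBI : (I • ⊤ : Submodule R B) = ⊥)
    (hA : A = ⊤) (hB : B = ⊤) (h : TorOneVanishes R A B) :
    (∃ (n : ℕ) (f : (Fin n → R) →ₗ[R] K), Function.Surjective f ∧
      LinearMap.ker f = J.piFin n) ∧
    ∃ (n : ℕ) (f : (Fin n → R) →ₗ[R] L), Function.Surjective f ∧
      LinearMap.ker f = I.piFin n := by
  subst hA hB
  have : Nontrivial (⊤ : Submodule R K) := Submodule.topEquiv.toEquiv.nontrivial
  have : Nontrivial (⊤ : Submodule R L) := Submodule.topEquiv.toEquiv.nontrivial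
  obtain ⟨n, f, hf, hkf⟩ := h.exists_cover_ker_eq hIJ hmax hAJ hBI
  obtain ⟨m, g, hg, hkg⟩ := h.symm.exists_cover_ker_eq hIJ.symm (sup_comm I J ▸ hmax) hBI hAJ
  refine ⟨⟨n, Submodule.topEquiv.toLinearMap ∘ₗ f, Submodule.topEquiv.surjective.comp hf, ?_⟩,
    ⟨m, Submodule.topEquiv.toLinearMap ∘ₗ g, Submodule.topEquiv.surjective.comp hg, ?_⟩⟩
  · rw [LinearEquiv.ker_comp, hkf]
  · rw [LinearEquiv.ker_comp, hkg]

/-- If `Tor₁(K, L) = 0` for nonzero modules `K` and `L`, each of which is the direct sum of a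
module killed by `J` and a module killed by `I`, then one is free over `R ⧸ J`, the other
over `R ⧸ I`. -/
theorem TorOneVanishes.exists_covers_of_isCompl (hIJ : Disjoint I J)
    (hmax : I ⊔ J = maximalIdeal R) (hI : I ≠ ⊥) (hJ : J ≠ ⊥) [Nontrivial K] [Nontrivial L]
    {A B : Submodule R K} {A' B' : Submodule R L} (hAB : IsCompl A B) (hAB' : IsCompl A' B')
    (hA : (J • ⊤ : Submodule R A) = ⊥) (hB : (I • ⊤ : Submodule R B) = ⊥)
    (hA' : (J • ⊤ : Submodule R A') = ⊥) (hB' : (I • ⊤ : Submodule R B') = ⊥)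
    (h : TorOneVanishes R K L) :
    ((∃ (n : ℕ) (f : (Fin n → R) →ₗ[R] K), Function.Surjective f ∧
        LinearMap.ker f = J.piFin n) ∧
      ∃ (n : ℕ) (f : (Fin n → R) →ₗ[R] L), Function.Surjective f ∧
        LinearMap.ker f = I.piFin n) ∨
    ((∃ (n : ℕ) (f : (Fin n → R) →ₗ[R] K), Function.Surjective f ∧
        LinearMap.ker f = I.piFin n) ∧
      ∃ (n : ℕ) (f : (Fin n → R) →ₗ[R] L), Function.Surjective f ∧
        LinearMap.ker f = J.piFin n) := by
  have hmax' : J ⊔ I = maximalIdeal R := sup_comm I J ▸ hmax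
  have hKA := h.of_isCompl_left hAB
  have hKB := h.of_isCompl_left hAB.symm
  have h1 := (hKA.of_isCompl_right hAB').subsingleton_or_subsingleton hIJ hmax hJ hA hA'
  have h2 := (hKB.of_isCompl_right hAB'.symm).subsingleton_or_subsingleton
    hIJ.symm hmax' hI hB hB'
  simp only [Submodule.subsingleton_iff_eq_bot] at h1 h2
  -- The outer two cases kill both summands of `K` or both of `L`, contradicting nontriviality; in
  -- the middle two, one summand of opposite type survives on each side.
  rcases h1 with rfl | rfl <;> rcases h2 with rfl | rfl
  · exact absurd (eq_bot_of_top_isCompl (eq_top_of_bot_isCompl hAB ▸ IsCompl.symm hAB)) top_ne_bot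
  · exact Or.inr (TorOneVanishes.exists_covers hIJ.symm hmax' hB hA' (eq_top_of_bot_isCompl hAB)
      (eq_top_of_isCompl_bot hAB') (hKB.of_isCompl_right hAB'))
  · exact Or.inl (TorOneVanishes.exists_covers hIJ hmax hA hB' (eq_top_of_isCompl_bot hAB)
      (eq_top_of_bot_isCompl hAB') (hKA.of_isCompl_right hAB'.symm))
  · exact absurd (eq_top_of_bot_isCompl hAB') bot_ne_top

end SplitSyzygies

/-! ### Splitting and nonvanishing of the second syzygy -/

namespace MinimalFreeResolution

variable {A : Type*} [CommRing A] [IsLocalRing A] {M : Type*} [AddCommGroup M] [Module A M]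
  (F : MinimalFreeResolution A M)

/-- The target of `F.d 0` is free, so its `I`- and `J`-multiples meet trivially. For the first
syzygy the target would be `M`, where they may overlap. -/
theorem isCompl_syzygySucc_one {I J : Ideal A} (hIJ : Disjoint I J)
    (hmax : I ⊔ J = maximalIdeal A) :
    IsCompl ((I.piFin _).comap (F.syzygySucc 1).subtype)
      ((J.piFin _).comap (F.syzygySucc 1).subtype) := by
  have hK : F.syzygySucc 1 = LinearMap.ker (F.d 0) := (LinearMap.exact_iff.1 (F.exact_succ 0)).symm
  rw [hK]
  refine isCompl_comap_piFin hIJ ?_ ?_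
  · rw [← hK, hmax]
    exact (F.minimal 1).trans (Ideal.smul_top_le_piFin _ _)
  · exact (Ideal.disjoint_piFin hIJ _).mono (Ideal.smul_top_le_piFin _ _)
      (Ideal.smul_top_le_piFin _ _)

theorem nontrivial_syzygySucc_one {R : Type u} [CommRing R] [IsLocalRing R]
    {M : Type u} [AddCommGroup M] [Module R M] (F : MinimalFreeResolution R M)
    (h : ¬ projectiveDimension (ModuleCat.of R M) ≤ 1) : Nontrivial (F.syzygySucc 1) := by
  rw [Submodule.nontrivial_iff_ne_bot]
  intro h0
  refine h (projectiveDimension_le_one_of_exact (f := F.d 0) ?_ F.exact_zero F.ε_surjective)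
  rw [← LinearMap.ker_eq_bot, LinearMap.exact_iff.1 (F.exact_succ 0)]
  exact h0

end MinimalFreeResolution

/-! ### Recognizing free modules over a quotient ring -/

theorem isFreeModuleAlong_of_addEquiv {A B : Type*} [CommRing A] [CommRing B] {η : A →+* B}
    {K P : Type*} [AddCommGroup K] [Module A K] [AddCommGroup P] [Module B P] [Module.Free B P]
    (e : K ≃+ P) (he : ∀ (a : A) (x : K), e (a • x) = η a • e x) : IsFreeModuleAlong η K := by
  let inst : Module B K := e.module B
  have hs (b : B) (x : K) : b • x = e.symm (b • e x) := rfl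
  refine ⟨inst, fun a x => ?_, ?_⟩
  · rw [hs, ← he, e.symm_apply_apply]
  · let e' : K ≃ₗ[B] P :=
      { e with map_smul' := fun b x => by simp [hs] }
    exact Module.Free.of_equiv e'.symm

theorem isFreeModuleAlong_of_ker_eq {A B : Type*} [CommRing A] [CommRing B] {η : A →+* B}
    (hη : Function.Surjective η) {K : Type*} [AddCommGroup K] [Module A K] {n : ℕ}
    {f : (Fin n → A) →ₗ[A] K} (hf : Function.Surjective f)
    (hk : LinearMap.ker f = (RingHom.ker η).piFin n) : IsFreeModuleAlong η K := by
  let : Module A B := Module.compHom B η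
  let g : (Fin n → A) →ₗ[A] (Fin n → B) :=
    { toFun := fun x i => η (x i)
      map_add' := fun x y => funext fun i => map_add η (x i) (y i)
      map_smul' := fun a x => funext fun i => map_mul η a (x i) }
  have hg : Function.Surjective g := fun y => by
    choose x hx using fun i => hη (y i)
    exact ⟨x, funext hx⟩
  -- Both `K` and `Bⁿ` are quotients of `Aⁿ` by the same submodule.
  have hgk : LinearMap.ker g = LinearMap.ker f := by
    ext x
    rw [hk, Ideal.mem_piFin]
    exact funext_iff
  let e : K ≃ₗ[A] (Fin n → B) := (f.quotKerEquivOfSurjective hf).symm ≪≫ₗ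
    Submodule.quotEquivOfEq _ _ hgk.symm ≪≫ₗ g.quotKerEquivOfSurjective hg
  exact isFreeModuleAlong_of_addEquiv e.toAddEquiv fun a x => map_smul e a x

/-! ### The maximal ideal of the fiber product -/

namespace fiberProduct

variable {S T k : Type*} [CommRing S] [IsLocalRing S] [CommRing T] [IsLocalRing T] [Field k]
  (eS : ResidueField S ≃+* k) (eT : ResidueField T ≃+* k)

theorem etaS_surjective : Function.Surjective (etaS eS eT) :=
  RingHom.surjective_pullbackFst_of_surjective _ _ (residueMap_surjective eT)

theorem etaT_surjective : Function.Surjective (etaT eS eT) :=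
  RingHom.surjective_pullbackSnd_of_surjective _ _ (residueMap_surjective eS)

theorem disjoint_ker : Disjoint (RingHom.ker (etaT eS eT)) (RingHom.ker (etaS eS eT)) := by
  rw [Submodule.disjoint_def]
  exact fun x hT hS => Subtype.ext (Prod.ext hS hT)

theorem residueMap_eq_zero_iff {A : Type*} [CommRing A] [IsLocalRing A] (e : ResidueField A ≃+* k)
    {a : A} : residueMap e a = 0 ↔ a ∈ maximalIdeal A := by
  rw [← residue_eq_zero_iff]
  exact map_eq_zero_iff e e.injective

theorem inl_mem {s : S} (hs : residueMap eS s = 0) : (s, 0) ∈ fiberProduct eS eT := by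
  change residueMap eS s = residueMap eT 0
  rw [hs, map_zero]

theorem inr_mem {t : T} (ht : residueMap eT t = 0) : (0, t) ∈ fiberProduct eS eT := by
  change residueMap eS 0 = residueMap eT t
  rw [ht, map_zero]

theorem sup_ker :
    RingHom.ker (etaT eS eT) ⊔ RingHom.ker (etaS eS eT) = maximalIdeal (fiberProduct eS eT) := by
  refine le_antisymm (sup_le (le_maximalIdeal (RingHom.ker_ne_top _))
    (le_maximalIdeal (RingHom.ker_ne_top _))) fun x hx => ?_
  have hsurj := (residueMap_surjective eS).comp (etaS_surjective eS eT)
  -- A surjection from a local ring onto a field is local, so it sends the nonunit `x` to zero.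
  have : IsLocalHom ((residueMap eS).comp (etaS eS eT)) := IsLocalHom.of_surjective _ hsurj
  have h1 : residueMap eS x.1.1 = 0 := by
    by_contra h0
    exact hx (isUnit_of_map_unit ((residueMap eS).comp (etaS eS eT)) x (IsUnit.mk0 _ h0))
  have h2 : residueMap eT x.1.2 = 0 := x.2.symm.trans h1
  refine Submodule.mem_sup.2 ⟨⟨(x.1.1, 0), inl_mem eS eT h1⟩, rfl,
    ⟨(0, x.1.2), inr_mem eS eT h2⟩, rfl, ?_⟩
  exact Subtype.ext (Prod.ext (add_zero _) (zero_add _))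

theorem ker_etaT_ne_bot (hS : ¬ IsField S) : RingHom.ker (etaT eS eT) ≠ ⊥ := by
  obtain ⟨s, hs, hs0⟩ := Submodule.exists_mem_ne_zero_of_ne_bot
    (fun h => hS (isField_iff_maximalIdeal_eq.2 h))
  intro h
  have hx : (⟨(s, 0), inl_mem eS eT ((residueMap_eq_zero_iff eS).2 hs)⟩ :
    fiberProduct eS eT) ∈ RingHom.ker (etaT eS eT) := rfl
  rw [h] at hx
  exact hs0 (congrArg (fun y => y.1.1) hx)

theorem ker_etaS_ne_bot (hT : ¬ IsField T) : RingHom.ker (etaS eS eT) ≠ ⊥ := by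
  obtain ⟨t, ht, ht0⟩ := Submodule.exists_mem_ne_zero_of_ne_bot
    (fun h => hT (isField_iff_maximalIdeal_eq.2 h))
  intro h
  have hx : (⟨(0, t), inr_mem eS eT ((residueMap_eq_zero_iff eT).2 ht)⟩ :
    fiberProduct eS eT) ∈ RingHom.ker (etaS eS eT) := rfl
  rw [h] at hx
  exact ht0 (congrArg (fun y => y.1.2) hx)

end fiberProduct

/-! ### The main theorem -/

theorem mainTheorem5 {S T : Type u} {k : Type*}
    [CommRing S] [IsLocalRing S] [IsNoetherianRing S]
    [CommRing T] [IsLocalRing T] [IsNoetherianRing T] [Field k]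
    (eS : ResidueField S ≃+* k) (eT : ResidueField T ≃+* k)
    (hS : ¬ IsField S) (hT : ¬ IsField T)
    (M N : Type u)
    [AddCommGroup M] [Module (fiberProduct eS eT) M] [Module.Finite (fiberProduct eS eT) M]
    [AddCommGroup N] [Module (fiberProduct eS eT) N] [Module.Finite (fiberProduct eS eT) N]
    (hTor : Limits.IsZero
      (((Tor (ModuleCat.{u} (fiberProduct eS eT)) 5).obj
        (ModuleCat.of (fiberProduct eS eT) M)).obj (ModuleCat.of (fiberProduct eS eT) N)))
    (F : MinimalFreeResolution (fiberProduct eS eT) M)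
    (G : MinimalFreeResolution (fiberProduct eS eT) N) :
    projectiveDimension (ModuleCat.of (fiberProduct eS eT) M) ≤ 1 ∨
    projectiveDimension (ModuleCat.of (fiberProduct eS eT) N) ≤ 1 ∨
    (IsFreeModuleAlong (fiberProduct.etaS eS eT) (F.syzygySucc 1) ∧
      IsFreeModuleAlong (fiberProduct.etaT eS eT) (G.syzygySucc 1)) ∨
    (IsFreeModuleAlong (fiberProduct.etaT eS eT) (F.syzygySucc 1) ∧
      IsFreeModuleAlong (fiberProduct.etaS eS eT) (G.syzygySucc 1)) := by
  by_cases hM : projectiveDimension (ModuleCat.of (fiberProduct eS eT) M) ≤ 1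
  · exact Or.inl hM
  by_cases hN : projectiveDimension (ModuleCat.of (fiberProduct eS eT) N) ≤ 1
  · exact Or.inr (Or.inl hN)
  refine Or.inr (Or.inr ?_)
  have := F.nontrivial_syzygySucc_one hM
  have := G.nontrivial_syzygySucc_one hN
  -- Here `I` is the kernel of `etaT` and `J` that of `etaS`, so a cover with kernel `Jⁿ` gives
  -- freeness over `S`, one with kernel `Iⁿ` freeness over `T`.
  have hIJ := fiberProduct.disjoint_ker eS eT
  have hmax := fiberProduct.sup_ker eS eT
  have hTor₁ : TorOneVanishes (fiberProduct eS eT) (F.syzygySucc 1) (G.syzygySucc 1) :=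
    .of_presentation (F.exact_syzygySucc_succ 1) (F.d 1).surjective_rangeRestrict
      (rTensor_syzygy_injective_of_isZero_tor hTor F G)
  have hηS := fiberProduct.etaS_surjective eS eT
  have hηT := fiberProduct.etaT_surjective eS eT
  refine (hTor₁.exists_covers_of_isCompl hIJ hmax (fiberProduct.ker_etaT_ne_bot eS eT hS)
    (fiberProduct.ker_etaS_ne_bot eS eT hT) (F.isCompl_syzygySucc_one hIJ hmax)
    (G.isCompl_syzygySucc_one hIJ hmax) (Ideal.smul_top_comap_piFin_eq_bot hIJ _)
    (Ideal.smul_top_comap_piFin_eq_bot hIJ.symm _) (Ideal.smul_top_comap_piFin_eq_bot hIJ _)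
    (Ideal.smul_top_comap_piFin_eq_bot hIJ.symm _)).imp ?_ ?_
  · rintro ⟨⟨n, f, hf, hkf⟩, m, g, hg, hkg⟩
    exact ⟨isFreeModuleAlong_of_ker_eq hηS hf hkf, isFreeModuleAlong_of_ker_eq hηT hg hkg⟩
  · rintro ⟨⟨n, f, hf, hkf⟩, m, g, hg, hkg⟩
    exact ⟨isFreeModuleAlong_of_ker_eq hηT hf hkf, isFreeModuleAlong_of_ker_eq hηS hg hkg⟩
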